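/- Let $n\ge 1$. A rank-one quantum game with finite-dimensional registers $\mathcal H_A,\mathcal H_B,\mathcal H_C$ is given by unit vectors $|\psi\rangle,|\gamma\rangle\in\mathcal H_A\otimes\mathcal H_B\otimes\mathcal H_C$. The referee prepares $|\psi\rangle$, keeps $C$, sends $A$ to Alice and $B$ to Bob, receives these registers back, and measures $ABC$ with $\{|\gamma\rangle\langle\gamma|,\,1-|\gamma\rangle\langle\gamma|\}$; the players win if the outcome is $|\gamma\rangle\langle\gamma|$. The game has local dimension $n$ if $\mathcal H_A=\mathcal H_B=\mathbb C^n$. A quantum operation on a finite-dimensional Hilbert space is a completely positive trace-preserving linear map. For a rank-one quantum game $G$: * $\omega^*(G)$ is the supremum of the winning probabilities when the players share a state $|\varphi\rangle\in\mathcal H_{A'}\otimes\mathcal H_{B'}$ (any finite dimensions), Alice applies a quantum operation to $\mathcal H_A\otimes\mathcal H_{A'}$ and Bob one to $\mathcal H_B\otimes\mathcal H_{B'}$; * $\omega_{qow}(G)$ is the supremum of the winning probabilities when an auxiliary register $A'$ (any finite dimension) starts in a fixed state $|0\rangle$, Alice applies a quantum operation to $\mathcal H_A\otimes\mathcal H_{A'}$,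 and then Bob applies one to $\mathcal H_B\otimes\mathcal H_{A'}$; * $V(G)$ is the supremum of the winning probabilities of a single player who has both $A$ and $B$ and an auxiliary register $E$ (any finite dimension) in a state of his choice, and applies a quantum operation to $\mathcal H_A\otimes\mathcal H_B\otimes\mathcal H_E$. With $\mathcal H_A=\mathcal H_B=\mathcal H_C=\mathbb C^n$, let $G_C$ be the game with $$|\psi\rangle=\tfrac1{\sqrt n}\sum_{i=1}^n|i\rangle|1\rangle|i\rangle,\qquad |\gamma\rangle=\tfrac1{\sqrt n}\sum_{i=1}^n|1\rangle|i\rangle|i\rangle,$$ and let $G_R$ be the game with $$|\psi\rangle=\tfrac1{\sqrt n}\sum_{i=1}^n|1\rangle|i\rangle|i\rangle,\qquad |\gamma\rangle=\tfrac1{\sqrt n}\sum_{i=1}^n|i\rangle|1\rangle|i\rangle .$$ Theorem. One has $$\frac{\omega_{qow}(G_C)}{\omega^*(G_C)}=n^2\qquad\text{and}\qquad \frac{V(G_R)}{\omega_{qow}(G_R)}=n^2 .$$ These separations are optimal in the dimension of the games: for every rank-one quantum game $G$ of local dimension $n$, with $\mathcal H_C$ of any finite dimension, $$\omega_{qow}(G)\le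 n^2\,\omega^*(G)\qquad\text{and}\qquad V(G)\le n^2\,\omega_{qow}(G).$$ -/

import Mathlib

open scoped ComplexOrder Kronecker

noncomputable section

namespace QuantumGame

section Operations

variable {R E S : Type*}

/-- `onRegister e T` is the map `T ⊗ id_E` acting on the matrices of a composite system `S`, where
`e` displays `S` as the register `R` together with the remaining registers `E`: the map `T` is
applied to each `R`-block of the matrix. -/
def onRegister (e : S ≃ R × E) (T : Matrix R R ℂ →ₗ[ℂ] Matrix R R ℂ) (X : Matrix S S ℂ) :
    Matrix S S ℂ :=
  Matrix.of fun s t =>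
    T (Matrix.of fun i j => X (e.symm (i, (e s).2)) (e.symm (j, (e t).2))) (e s).1 (e t).1

/-- A quantum operation on the register with Hilbert space `ℂ^R`: a completely positive, trace
preserving linear map. -/
structure IsQuantumOperation [Fintype R] (T : Matrix R R ℂ →ₗ[ℂ] Matrix R R ℂ) : Prop where
  completelyPositive : ∀ (k : ℕ) (X : Matrix (R × Fin k) (R × Fin k) ℂ),
    X.PosSemidef → (onRegister (Equiv.refl (R × Fin k)) T X).PosSemidef
  tracePreserving : ∀ X : Matrix R R ℂ, (T X).trace = X.trace

/-- The vector `|v⟩ ⊗ |w⟩`. -/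
def tensorVec {ι κ : Type*} (v : EuclideanSpace ℂ ι) (w : EuclideanSpace ℂ κ) :
    EuclideanSpace ℂ (ι × κ) :=
  WithLp.toLp 2 fun x => v x.1 * w x.2

/-- The operator `|v⟩⟨v|`. -/
def ketBra {ι : Type*} (v : EuclideanSpace ℂ ι) : Matrix ι ι ℂ :=
  Matrix.of fun x y => v x * star (v y)

end Operations

/-- A rank-one quantum game with Alice's, Bob's and the referee's registers `ℂ^A`, `ℂ^B`, `ℂ^C`:
the referee prepares the state `ψ` and, in the end, measures `{|γ⟩⟨γ|, 1 - |γ⟩⟨γ|}`. -/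
structure RankOneGame (A B C : Type*) [Fintype A] [Fintype B] [Fintype C] where
  ψ : EuclideanSpace ℂ (A × B × C)
  γ : EuclideanSpace ℂ (A × B × C)
  norm_ψ : ‖ψ‖ = 1
  norm_γ : ‖γ‖ = 1

section Registers

variable (A B C A' B' E : Type*)

/-- `A A'` against the rest in the system `A B C A' B'`. -/
def splitAliceEnt : (A × B × C) × (A' × B') ≃ (A × A') × (B × C × B') where
  toFun x := ((x.1.1, x.2.1), (x.1.2.1, x.1.2.2, x.2.2))
  invFun y := ((y.1.1, y.2.1, y.2.2.1), (y.1.2, y.2.2.2))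
  left_inv _ := rfl
  right_inv _ := rfl

/-- `B B'` against the rest in the system `A B C A' B'`. -/
def splitBobEnt : (A × B × C) × (A' × B') ≃ (B × B') × (A × C × A') where
  toFun x := ((x.1.2.1, x.2.2), (x.1.1, x.1.2.2, x.2.1))
  invFun y := ((y.2.1, y.1.1, y.2.2.1), (y.2.2.2, y.1.2))
  left_inv _ := rfl
  right_inv _ := rfl

/-- `A A'` against the rest in the system `A B C A'`. -/
def splitAliceOneWay : (A × B × C) × A' ≃ (A × A') × (B × C) where
  toFun x := ((x.1.1, x.2), (x.1.2.1, x.1.2.2))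
  invFun y := ((y.1.1, y.2.1, y.2.2), y.1.2)
  left_inv _ := rfl
  right_inv _ := rfl

/-- `B A'` against the rest in the system `A B C A'`. -/
def splitBobOneWay : (A × B × C) × A' ≃ (B × A') × (A × C) where
  toFun x := ((x.1.2.1, x.2), (x.1.1, x.1.2.2))
  invFun y := ((y.2.1, y.1.1, y.2.2), y.1.2)
  left_inv _ := rfl
  right_inv _ := rfl

/-- `A B E` against the referee's register in the system `A B C E`. -/
def splitJoint : (A × B × C) × E ≃ (A × B × E) × C where
  toFun x := ((x.1.1, x.1.2.1, x.2), x.1.2.2)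
  invFun y := ((y.1.1, y.1.2.1, y.2), y.1.2.2)
  left_inv _ := rfl
  right_inv _ := rfl

end Registers

namespace RankOneGame

variable {A B C : Type*} [Fintype A] [Fintype B] [Fintype C]

/-- The probability `tr((|γ⟩⟨γ| ⊗ 1_E) ρ)` that the referee accepts, when the final state of the
registers `A B C` and of the auxiliary registers `E` is `ρ`. -/
def acceptProb (G : RankOneGame A B C) {E : Type*} [Fintype E] [DecidableEq E]
    (ρ : Matrix ((A × B × C) × E) ((A × B × C) × E) ℂ) : ℝ :=
  ((ketBra G.γ ⊗ₖ (1 : Matrix E E ℂ)) * ρ).trace.re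

/-- The set of winning probabilities of strategies with shared entanglement: the players share a
state `φ ∈ ℂ^k ⊗ ℂ^l`, Alice applies a quantum operation to `A A'` and Bob one to `B B'`. -/
def entangledProbs (G : RankOneGame A B C) : Set ℝ :=
  {p | ∃ (k l : ℕ) (φ : EuclideanSpace ℂ (Fin k × Fin l))
      (T : Matrix (A × Fin k) (A × Fin k) ℂ →ₗ[ℂ] Matrix (A × Fin k) (A × Fin k) ℂ)
      (S : Matrix (B × Fin l) (B × Fin l) ℂ →ₗ[ℂ] Matrix (B × Fin l) (B × Fin l) ℂ),
      ‖φ‖ = 1 ∧ IsQuantumOperation T ∧ IsQuantumOperation S ∧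
      p = G.acceptProb
        (onRegister (splitAliceEnt A B C (Fin k) (Fin l)) T
          (onRegister (splitBobEnt A B C (Fin k) (Fin l)) S (ketBra (tensorVec G.ψ φ))))}

/-- The entangled value `ω*(G)`. -/
def entangledValue (G : RankOneGame A B C) : ℝ := sSup G.entangledProbs

/-- The set of winning probabilities of strategies with one-way quantum communication: an
auxiliary register `A'` of dimension `k + 1` starts in the state `|0⟩`, Alice applies a quantum
operation to `A A'` and sends `A'` to Bob, who then applies a quantum operation to `B A'`. -/
def oneWayProbs (G : RankOneGame A B C) : Set ℝ :=
  {p | ∃ (k : ℕ)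
      (T : Matrix (A × Fin (k + 1)) (A × Fin (k + 1)) ℂ →ₗ[ℂ]
        Matrix (A × Fin (k + 1)) (A × Fin (k + 1)) ℂ)
      (S : Matrix (B × Fin (k + 1)) (B × Fin (k + 1)) ℂ →ₗ[ℂ]
        Matrix (B × Fin (k + 1)) (B × Fin (k + 1)) ℂ),
      IsQuantumOperation T ∧ IsQuantumOperation S ∧
      p = G.acceptProb
        (onRegister (splitBobOneWay A B C (Fin (k + 1))) S
          (onRegister (splitAliceOneWay A B C (Fin (k + 1))) T
            (ketBra (tensorVec G.ψ (EuclideanSpace.single 0 1)))))}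

/-- The entangled value with one-way communication from Alice to Bob, `ω_qow(G)`. -/
def oneWayValue (G : RankOneGame A B C) : ℝ := sSup G.oneWayProbs

/-- The set of winning probabilities of a single player who has access to both registers `A` and
`B` and to an auxiliary register `E` in a state `η` of his choice. -/
def jointProbs (G : RankOneGame A B C) : Set ℝ :=
  {p | ∃ (k : ℕ) (η : EuclideanSpace ℂ (Fin k))
      (T : Matrix (A × B × Fin k) (A × B × Fin k) ℂ →ₗ[ℂ]
        Matrix (A × B × Fin k) (A × B × Fin k) ℂ),
      ‖η‖ = 1 ∧ IsQuantumOperation T ∧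
      p = G.acceptProb (onRegister (splitJoint A B C (Fin k)) T (ketBra (tensorVec G.ψ η)))}

/-- The maximal value `V(G)`. -/
def maximalValue (G : RankOneGame A B C) : ℝ := sSup G.jointProbs

end RankOneGame

/-- `n^{-1/2} ∑ᵢ |f i⟩`. -/
def uniformState {ι : Type*} [DecidableEq ι] (n : ℕ) (f : Fin n → ι) : EuclideanSpace ℂ ι :=
  ((1 / Real.sqrt n : ℝ) : ℂ) • ∑ i, EuclideanSpace.single (f i) (1 : ℂ)

theorem norm_uniformState {ι : Type*} [Fintype ι] [DecidableEq ι] (n : ℕ) [NeZero n]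
    (f : Fin n → ι) (hf : Function.Injective f) : ‖uniformState n f‖ = 1 := by
  have hn : (0 : ℝ) < n := by exact_mod_cast Nat.pos_of_ne_zero (NeZero.ne n)
  have h : ‖∑ i, EuclideanSpace.single (f i) (1 : ℂ)‖ ^ 2 = (n : ℝ) := by
    have ho : Orthonormal ℂ (fun i => EuclideanSpace.single (f i) (1 : ℂ)) :=
      (EuclideanSpace.orthonormal_single (𝕜 := ℂ) (ι := ι)).comp f hf
    have h2 := ho.inner_sum (fun _ => 1) (fun _ => 1) Finset.univ
    simp only [one_smul, map_one, mul_one, Finset.sum_const, Finset.card_univ, Fintype.card_fin,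
      nsmul_eq_mul] at h2
    rw [inner_self_eq_norm_sq_to_K] at h2
    exact Complex.ofReal_injective (by simpa using h2)
  have h' : ‖∑ i, EuclideanSpace.single (f i) (1 : ℂ)‖ = Real.sqrt n := by
    rw [← h, Real.sqrt_sq (norm_nonneg _)]
  rw [uniformState, norm_smul, h', Complex.norm_real, Real.norm_of_nonneg (by positivity)]
  exact one_div_mul_cancel (Real.sqrt_pos.mpr hn).ne'

/-- The game `G_C`, with `ψ = n^{-1/2} ∑ᵢ |i1⟩|i⟩` and `γ = n^{-1/2} ∑ᵢ |1i⟩|i⟩`; the basis vector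
`|1⟩` has index `0 : Fin n`. -/
def gameC (n : ℕ) [NeZero n] : RankOneGame (Fin n) (Fin n) (Fin n) where
  ψ := uniformState n fun i => (i, 0, i)
  γ := uniformState n fun i => (0, i, i)
  norm_ψ := norm_uniformState n _ fun _ _ h => congrArg Prod.fst h
  norm_γ := norm_uniformState n _ fun _ _ h => congrArg (fun x => x.2.1) h

/-- The game `G_R`, with `ψ = n^{-1/2} ∑ᵢ |1i⟩|i⟩` and `γ = n^{-1/2} ∑ᵢ |i1⟩|i⟩`. -/
def gameR (n : ℕ) [NeZero n] : RankOneGame (Fin n) (Fin n) (Fin n) where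
  ψ := uniformState n fun i => (0, i, i)
  γ := uniformState n fun i => (i, 0, i)
  norm_ψ := norm_uniformState n _ fun _ _ h => congrArg (fun x => x.2.1) h
  norm_γ := norm_uniformState n _ fun _ _ h => congrArg Prod.fst h

end QuantumGame

end

/-! Both general inequalities come from teleportation without correction: measure an input together
with half of a maximally entangled pair and keep only the Bell outcome `Φ`. On that branch, of
weight `n⁻²`, the input has in effect been inserted into an operation that was already applied to
the other half. The other branches contribute nonnegatively, so the strategy wins with probability
at least `n⁻²` times that of the simulated one. For `oneWayValue_le` the shared state is the Choi
state of Alice's operation: Alice teleports her input into it, and Bob already holds the message.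
For `maximalValue_le` Alice runs the joint operation on half of a maximally entangled pair, and Bob
teleports his input into it. The special games are won perfectly in the stronger model by swapping
registers. In the weaker model, enlarge `|γ⟩⟨γ|` to the identity on one player's register tensored
with the projector onto `Φ` on the other player's register and `C`. The first player's operation
then drops out by trace preservation. The second player acts on registers uncorrelated with the
maximally mixed `C`, so the overlap with `Φ` is exactly `n⁻²`. The weaker values need no explicit
optimal strategy: `1 ≤ u ≤ n² v ≤ 1` forces `u / v = n²`. -/

namespace QuantumGame

/-! ### Completely positive maps and quantum operations on a register. -/

section Operations

variable {R R' E S : Type*}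

/-- The map `T ⊗ id_E` as a linear map. -/
def registerMap (e : S ≃ R × E) (T : Matrix R R ℂ →ₗ[ℂ] Matrix R R ℂ) :
    Matrix S S ℂ →ₗ[ℂ] Matrix S S ℂ where
  toFun := onRegister e T
  map_add' X Y := by
    ext s t
    exact congrFun₂ (T.map_add (Matrix.of fun i j => X (e.symm (i, (e s).2)) (e.symm (j, (e t).2)))
      (Matrix.of fun i j => Y (e.symm (i, (e s).2)) (e.symm (j, (e t).2)))) _ _
  map_smul' c X := by
    ext s t
    exact congrFun₂ (T.map_smul c
      (Matrix.of fun i j => X (e.symm (i, (e s).2)) (e.symm (j, (e t).2)))) _ _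

theorem registerMap_apply (e : S ≃ R × E) (T : Matrix R R ℂ →ₗ[ℂ] Matrix R R ℂ)
    (X : Matrix S S ℂ) : registerMap e T X = onRegister e T X := rfl

theorem onRegister_apply (e : S ≃ R × E) (T : Matrix R R ℂ →ₗ[ℂ] Matrix R R ℂ)
    (X : Matrix S S ℂ) (s t : S) :
    onRegister e T X s t =
      T (Matrix.of fun i j => X (e.symm (i, (e s).2)) (e.symm (j, (e t).2))) (e s).1 (e t).1 := rfl

theorem onRegister_add (e : S ≃ R × E) (T U : Matrix R R ℂ →ₗ[ℂ] Matrix R R ℂ)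
    (X : Matrix S S ℂ) : onRegister e (T + U) X = onRegister e T X + onRegister e U X := rfl

theorem onRegister_comp (e : S ≃ R × E) (T U : Matrix R R ℂ →ₗ[ℂ] Matrix R R ℂ)
    (X : Matrix S S ℂ) : onRegister e (T ∘ₗ U) X = onRegister e T (onRegister e U X) := by
  ext s t
  simp only [onRegister_apply, LinearMap.comp_apply, Equiv.apply_symm_apply]
  rfl

/-- Linear maps that remain positive after tensoring with the identity of any register. -/
def IsCompletelyPositive (T : Matrix R R ℂ →ₗ[ℂ] Matrix R R ℂ) : Prop :=
  ∀ (k : ℕ) (X : Matrix (R × Fin k) (R × Fin k) ℂ),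
    X.PosSemidef → (onRegister (Equiv.refl (R × Fin k)) T X).PosSemidef

/-- Complete positivity is stated for ancillas `Fin k`; enumerating `E` carries it over to any
finite environment. -/
theorem IsCompletelyPositive.posSemidef_onRegister [Finite E]
    {T : Matrix R R ℂ →ₗ[ℂ] Matrix R R ℂ} (hT : IsCompletelyPositive T) (e : S ≃ R × E)
    {X : Matrix S S ℂ} (hX : X.PosSemidef) : (onRegister e T X).PosSemidef := by
  obtain ⟨k, ⟨f⟩⟩ := Finite.exists_equiv_fin E
  have h := (hT k _ (hX.submatrix fun y : R × Fin k => e.symm (y.1, f.symm y.2))).submatrix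
    fun s => ((e s).1, f (e s).2)
  convert h using 1
  ext s t
  simp [onRegister_apply]

theorem IsCompletelyPositive.comp {T U : Matrix R R ℂ →ₗ[ℂ] Matrix R R ℂ}
    (hT : IsCompletelyPositive T) (hU : IsCompletelyPositive U) :
    IsCompletelyPositive (T ∘ₗ U) := fun k X hX => by
  rw [onRegister_comp]
  exact hT k _ (hU k X hX)

theorem IsCompletelyPositive.add {T U : Matrix R R ℂ →ₗ[ℂ] Matrix R R ℂ}
    (hT : IsCompletelyPositive T) (hU : IsCompletelyPositive U) :
    IsCompletelyPositive (T + U) := fun k X hX => (hT k X hX).add (hU k X hX)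

/-- Adding an ancilla to `T ⊗ id_E` gives `T` tensored with the identity of the single environment
`E × Fin k`. -/
theorem IsCompletelyPositive.registerMap [Finite E] {T : Matrix R R ℂ →ₗ[ℂ] Matrix R R ℂ}
    (hT : IsCompletelyPositive T) (e : S ≃ R × E) :
    IsCompletelyPositive (registerMap e T) := fun k X hX => by
  let e' : S × Fin k ≃ R × (E × Fin k) :=
    (e.prodCongr (Equiv.refl _)).trans (Equiv.prodAssoc _ _ _)
  exact hT.posSemidef_onRegister e' hX

/-- A linear map on the matrices of `R`, transported along `f : R ≃ R'`. -/
def transport (f : R ≃ R') (T : Matrix R R ℂ →ₗ[ℂ] Matrix R R ℂ) :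
    Matrix R' R' ℂ →ₗ[ℂ] Matrix R' R' ℂ :=
  registerMap (f.symm.trans (Equiv.prodUnique R Unit).symm) T

theorem transport_apply (f : R ≃ R') (T : Matrix R R ℂ →ₗ[ℂ] Matrix R R ℂ)
    (X : Matrix R' R' ℂ) : transport f T X = (T (X.submatrix f f)).submatrix f.symm f.symm := rfl

section Finite

variable [Fintype R]

/-- A trace preserving map on a register does not change the state of the other registers. -/
theorem IsQuantumOperation.sum_onRegister {T : Matrix R R ℂ →ₗ[ℂ] Matrix R R ℂ}
    (hT : IsQuantumOperation T) (e : S ≃ R × E) (X : Matrix S S ℂ) (u v : E) :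
    ∑ r, onRegister e T X (e.symm (r, u)) (e.symm (r, v)) =
      ∑ r, X (e.symm (r, u)) (e.symm (r, v)) := by
  have h := hT.tracePreserving (Matrix.of fun i j => X (e.symm (i, u)) (e.symm (j, v)))
  simpa [onRegister_apply, Matrix.trace] using h

theorem IsQuantumOperation.trace_onRegister [Fintype E] [Fintype S] {T : Matrix R R ℂ →ₗ[ℂ] Matrix R R ℂ}
    (hT : IsQuantumOperation T) (e : S ≃ R × E) (X : Matrix S S ℂ) :
    (onRegister e T X).trace = X.trace := by
  simp only [Matrix.trace, Matrix.diag]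
  rw [← e.symm.sum_comp, ← e.symm.sum_comp (fun s => X s s), Fintype.sum_prod_type_right,
    Fintype.sum_prod_type_right]
  exact Finset.sum_congr rfl fun u _ => hT.sum_onRegister e X u u

theorem IsQuantumOperation.posSemidef_onRegister [Finite E] {T : Matrix R R ℂ →ₗ[ℂ] Matrix R R ℂ}
    (hT : IsQuantumOperation T) (e : S ≃ R × E) {X : Matrix S S ℂ} (hX : X.PosSemidef) :
    (onRegister e T X).PosSemidef :=
  IsCompletelyPositive.posSemidef_onRegister hT.completelyPositive e hX

theorem IsQuantumOperation.comp {T U : Matrix R R ℂ →ₗ[ℂ] Matrix R R ℂ}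
    (hT : IsQuantumOperation T) (hU : IsQuantumOperation U) : IsQuantumOperation (T ∘ₗ U) :=
  ⟨IsCompletelyPositive.comp hT.completelyPositive hU.completelyPositive, fun X => by
    rw [LinearMap.comp_apply, hT.tracePreserving, hU.tracePreserving]⟩

theorem IsQuantumOperation.registerMap [Fintype E] [Fintype S] {T : Matrix R R ℂ →ₗ[ℂ] Matrix R R ℂ}
    (hT : IsQuantumOperation T) (e : S ≃ R × E) : IsQuantumOperation (registerMap e T) :=
  ⟨IsCompletelyPositive.registerMap hT.completelyPositive e, fun X => hT.trace_onRegister e X⟩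

theorem IsQuantumOperation.transport [Fintype R'] {T : Matrix R R ℂ →ₗ[ℂ] Matrix R R ℂ}
    (hT : IsQuantumOperation T) (f : R ≃ R') : IsQuantumOperation (transport f T) :=
  hT.registerMap _

/-- Relabelling the basis of a register along a permutation. -/
def permMap {R : Type*} (σ : R ≃ R) : Matrix R R ℂ →ₗ[ℂ] Matrix R R ℂ where
  toFun X := X.submatrix σ σ
  map_add' _ _ := rfl
  map_smul' _ _ := rfl

theorem isQuantumOperation_permMap (σ : R ≃ R) : IsQuantumOperation (permMap σ) where
  completelyPositive k _ hX := hX.submatrix fun y : R × Fin k => (σ y.1, y.2)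
  tracePreserving X := σ.sum_comp fun i => X i i

/-- The map `X ↦ K X Kᴴ`. -/
def conjMap (K : Matrix R R ℂ) : Matrix R R ℂ →ₗ[ℂ] Matrix R R ℂ :=
  LinearMap.mulRight ℂ K.conjTranspose ∘ₗ LinearMap.mulLeft ℂ K

theorem conjMap_apply (K X : Matrix R R ℂ) : conjMap K X = K * X * K.conjTranspose := rfl

theorem isCompletelyPositive_conjMap (K : Matrix R R ℂ) :
    IsCompletelyPositive (conjMap K) := fun k X hX => by
  have h := hX.mul_mul_conjTranspose_same (K ⊗ₖ (1 : Matrix (Fin k) (Fin k) ℂ))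
  convert h using 1
  ext s t
  simp [onRegister_apply, conjMap_apply, Matrix.mul_apply, Fintype.sum_prod_type,
    Matrix.one_apply, Finset.sum_mul, ite_mul, apply_ite]

open scoped MatrixOrder in
/-- A matrix `K` with `Kᴴ K ≤ 1` is one branch of a quantum operation. -/
theorem exists_isQuantumOperation_conjMap_add [DecidableEq R] (K : Matrix R R ℂ)
    (hK : (1 - K.conjTranspose * K).PosSemidef) :
    ∃ U, IsCompletelyPositive U ∧ IsQuantumOperation (conjMap K + U) := by
  -- The second Kraus operator is a square root `M` of the defect: `Mᴴ M = 1 - Kᴴ K`.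
  obtain ⟨M, hM⟩ := CStarAlgebra.nonneg_iff_eq_star_mul_self.mp hK.nonneg
  rw [Matrix.star_eq_conjTranspose] at hM
  refine ⟨conjMap M, isCompletelyPositive_conjMap M,
    (isCompletelyPositive_conjMap K).add (isCompletelyPositive_conjMap M), fun X => ?_⟩
  rw [LinearMap.add_apply, Matrix.trace_add, conjMap_apply, conjMap_apply, Matrix.mul_assoc,
    Matrix.trace_mul_comm, Matrix.mul_assoc, Matrix.mul_assoc M, Matrix.trace_mul_comm M,
    Matrix.mul_assoc X, ← hM, ← Matrix.trace_add, ← Matrix.mul_add]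
  simp

theorem ketBra_apply {ι : Type*} (v : EuclideanSpace ℂ ι) (x y : ι) :
    ketBra v x y = v x * star (v y) := rfl

theorem tensorVec_apply {ι κ : Type*} (v : EuclideanSpace ℂ ι) (w : EuclideanSpace ℂ κ)
    (x : ι × κ) : tensorVec v w x = v x.1 * w x.2 := rfl

theorem ketBra_tensorVec {ι κ : Type*} (v : EuclideanSpace ℂ ι) (w : EuclideanSpace ℂ κ) :
    ketBra (tensorVec v w) = ketBra v ⊗ₖ ketBra w := by
  ext x y
  simp [ketBra_apply, tensorVec_apply, mul_mul_mul_comm]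

theorem posSemidef_ketBra {ι : Type*} [Finite ι] (v : EuclideanSpace ℂ ι) :
    (ketBra v).PosSemidef :=
  Matrix.posSemidef_vecMulVec_self_star v.ofLp

theorem trace_ketBra {ι : Type*} [Fintype ι] (v : EuclideanSpace ℂ ι) :
    (ketBra v).trace = ((‖v‖ ^ 2 : ℝ) : ℂ) := by
  simp [Matrix.trace, ketBra_apply, EuclideanSpace.norm_sq_eq, Complex.mul_conj,
    Complex.normSq_eq_norm_sq]

/-- Discarding a register and preparing the state `κ` in it. -/
def prepareMap (κ : EuclideanSpace ℂ R) : Matrix R R ℂ →ₗ[ℂ] Matrix R R ℂ where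
  toFun X := X.trace • ketBra κ
  map_add' X Y := by rw [Matrix.trace_add, add_smul]
  map_smul' c X := by rw [Matrix.trace_smul, smul_assoc, RingHom.id_apply]

theorem prepareMap_apply (κ : EuclideanSpace ℂ R) (X : Matrix R R ℂ) :
    prepareMap κ X = X.trace • ketBra κ := rfl

theorem isQuantumOperation_prepareMap (κ : EuclideanSpace ℂ R) (hκ : ‖κ‖ = 1) :
    IsQuantumOperation (prepareMap κ) where
  completelyPositive k X hX := by
    classical
    -- The output is `|κ⟩⟨κ|` tensored with the partial trace of `X`, a sum of diagonal blocks.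
    have h : onRegister (Equiv.refl (R × Fin k)) (prepareMap κ) X =
        ∑ r, ketBra κ ⊗ₖ (X.submatrix (fun i : Fin k => (r, i)) fun i => (r, i)) := by
      ext s t
      simp [onRegister_apply, prepareMap_apply, Matrix.trace, Matrix.sum_apply, Finset.sum_mul,
        mul_comm (ketBra κ _ _)]
    rw [h]
    exact Matrix.posSemidef_sum _ fun r _ => (posSemidef_ketBra κ).kronecker (hX.submatrix _)
  tracePreserving X := by
    rw [prepareMap_apply, Matrix.trace_smul, trace_ketBra, hκ]
    simp

/-- Relabelling a register commutes with the operations on it. -/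
theorem onRegister_transport {R R' E E' S S' : Type*} (e : S ≃ R × E) (e' : S' ≃ R' × E')
    (f : R ≃ R') (h : E' → E) (g : S' → S)
    (hg : ∀ s, e (g s) = (f.symm (e' s).1, h (e' s).2))
    (T : Matrix R R ℂ →ₗ[ℂ] Matrix R R ℂ) (X : Matrix S S ℂ) :
    onRegister e' (transport f T) (X.submatrix g g) = (onRegister e T X).submatrix g g := by
  have hg' : ∀ i v, g (e'.symm (f i, v)) = e.symm (i, h v) := fun i v => by
    rw [Equiv.eq_symm_apply, hg]
    simp
  ext s t
  rw [onRegister_apply, transport_apply, Matrix.submatrix_apply, Matrix.submatrix_apply,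
    onRegister_apply, hg s, hg t]
  refine congrFun₂ (congrArg T ?_) _ _
  ext i j
  simp [hg']

open scoped MatrixOrder in
theorem re_trace_mul_nonneg {X Y : Matrix R R ℂ} (hX : X.PosSemidef) (hY : Y.PosSemidef) :
    0 ≤ (X * Y).trace.re := by
  classical
  obtain ⟨M, hM⟩ := CStarAlgebra.nonneg_iff_eq_star_mul_self.mp hX.nonneg
  rw [Matrix.star_eq_conjTranspose] at hM
  rw [hM, Matrix.mul_assoc, Matrix.trace_mul_comm]
  exact (Complex.nonneg_iff.mp (hY.mul_mul_conjTranspose_same M).trace_nonneg).1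

/-- If `W Wᴴ = 1` then `Wᴴ W ≤ 1`. -/
theorem posSemidef_one_sub_conjTranspose_mul [DecidableEq R] {Q : Type*} [Fintype Q]
    [DecidableEq Q] {W : Matrix Q R ℂ} (hW : W * W.conjTranspose = 1) :
    (1 - W.conjTranspose * W).PosSemidef := by
  have h : 1 - W.conjTranspose * W =
      (1 - W.conjTranspose * W).conjTranspose * (1 - W.conjTranspose * W) := by
    have h' : W.conjTranspose * W * (W.conjTranspose * W) = W.conjTranspose * W := by
      rw [Matrix.mul_assoc, ← Matrix.mul_assoc W, hW, Matrix.one_mul]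
    simp [Matrix.mul_sub, Matrix.sub_mul, h']
  rw [h]
  exact Matrix.posSemidef_conjTranspose_mul_self _

/-- The row vector `W = ⟨v|` satisfies `W Wᴴ = ‖v‖² = 1`, and `Wᴴ W = |v⟩⟨v|`. -/
theorem posSemidef_one_sub_ketBra [DecidableEq R] {v : EuclideanSpace ℂ R} (hv : ‖v‖ = 1) :
    (1 - ketBra v).PosSemidef := by
  have h := trace_ketBra v
  rw [hv] at h
  have hW : (Matrix.replicateRow Unit (star v.ofLp)) *
      (Matrix.replicateRow Unit (star v.ofLp)).conjTranspose = 1 := by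
    ext i j
    simpa [Matrix.mul_apply, Matrix.trace, ketBra_apply, mul_comm] using h
  have hv' : ketBra v = (Matrix.replicateRow Unit (star v.ofLp)).conjTranspose *
      Matrix.replicateRow Unit (star v.ofLp) := by
    ext i j
    simp [Matrix.mul_apply, ketBra_apply]
  rw [hv']
  exact posSemidef_one_sub_conjTranspose_mul hW

end Finite

end Operations

/-! ### Acceptance probabilities, and strategies with general auxiliary registers. -/

namespace RankOneGame

variable {A B C : Type*} [Fintype A] [Fintype B] [Fintype C]

section Accept

variable (G : RankOneGame A B C) {E E' : Type*} [Fintype E] [DecidableEq E] [Fintype E']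
  [DecidableEq E']

theorem acceptProb_eq_sum (ρ : Matrix ((A × B × C) × E) ((A × B × C) × E) ℂ) :
    G.acceptProb ρ =
      ∑ e, (ketBra G.γ * ρ.submatrix (fun x => (x, e)) fun x => (x, e)).trace.re := by
  rw [acceptProb, ← Complex.re_sum]
  congr 1
  simp only [Matrix.trace, Matrix.diag, Matrix.mul_apply]
  rw [Fintype.sum_prod_type_right]
  refine Finset.sum_congr rfl fun e _ => Finset.sum_congr rfl fun x _ => ?_
  rw [Fintype.sum_prod_type]
  refine Finset.sum_congr rfl fun y _ => ?_
  simp [Matrix.one_apply]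

theorem acceptProb_add (ρ σ : Matrix ((A × B × C) × E) ((A × B × C) × E) ℂ) :
    G.acceptProb (ρ + σ) = G.acceptProb ρ + G.acceptProb σ := by
  simp [acceptProb, Matrix.mul_add]

theorem acceptProb_sum {ι : Type*} (s : Finset ι)
    (ρ : ι → Matrix ((A × B × C) × E) ((A × B × C) × E) ℂ) :
    G.acceptProb (∑ i ∈ s, ρ i) = ∑ i ∈ s, G.acceptProb (ρ i) := by
  simp [acceptProb, Matrix.mul_sum, Matrix.trace_sum]

theorem acceptProb_smul (r : ℝ) (ρ : Matrix ((A × B × C) × E) ((A × B × C) × E) ℂ) :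
    G.acceptProb ((r : ℂ) • ρ) = r * G.acceptProb ρ := by
  simp [acceptProb]

theorem acceptProb_nonneg {ρ : Matrix ((A × B × C) × E) ((A × B × C) × E) ℂ}
    (hρ : ρ.PosSemidef) : 0 ≤ G.acceptProb ρ :=
  re_trace_mul_nonneg ((posSemidef_ketBra _).kronecker Matrix.PosSemidef.one) hρ

theorem acceptProb_le_trace {ρ : Matrix ((A × B × C) × E) ((A × B × C) × E) ℂ}
    (hρ : ρ.PosSemidef) : G.acceptProb ρ ≤ ρ.trace.re := by
  classical
  have h := re_trace_mul_nonneg ((posSemidef_one_sub_ketBra G.norm_γ).kronecker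
    (Matrix.PosSemidef.one (n := E))) hρ
  have h' : (1 - ketBra G.γ) ⊗ₖ (1 : Matrix E E ℂ) = 1 - ketBra G.γ ⊗ₖ 1 := by
    rw [eq_sub_iff_add_eq, ← Matrix.add_kronecker, sub_add_cancel, Matrix.one_kronecker_one]
  rw [h', Matrix.sub_mul, Matrix.one_mul, Matrix.trace_sub, Complex.sub_re] at h
  exact sub_nonneg.mp h

/-- Fixing part of the auxiliary registers' outcome can only decrease the acceptance
probability. -/
theorem acceptProb_submatrix_le {ρ : Matrix ((A × B × C) × E) ((A × B × C) × E) ℂ}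
    (hρ : ρ.PosSemidef) {f : E' → E} (hf : Function.Injective f) :
    G.acceptProb (ρ.submatrix (Prod.map id f) (Prod.map id f)) ≤ G.acceptProb ρ := by
  rw [acceptProb_eq_sum, acceptProb_eq_sum]
  exact (Finset.sum_map Finset.univ ⟨f, hf⟩ fun e =>
      (ketBra G.γ * ρ.submatrix (fun x => (x, e)) fun x => (x, e)).trace.re).symm.trans_le
    (Finset.sum_le_univ_sum_of_nonneg fun e =>
      re_trace_mul_nonneg (posSemidef_ketBra _) (hρ.submatrix _))

theorem acceptProb_submatrix_equiv (ρ : Matrix ((A × B × C) × E) ((A × B × C) × E) ℂ)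
    (f : E' ≃ E) :
    G.acceptProb (ρ.submatrix (Prod.map id f) (Prod.map id f)) = G.acceptProb ρ := by
  rw [acceptProb_eq_sum, acceptProb_eq_sum]
  exact f.sum_comp fun e => (ketBra G.γ * ρ.submatrix (fun x => (x, e)) fun x => (x, e)).trace.re

end Accept

section Values

variable (G : RankOneGame A B C)

theorem trace_ketBra_tensorVec_ψ {E : Type*} [Fintype E] {φ : EuclideanSpace ℂ E}
    (hφ : ‖φ‖ = 1) : (ketBra (tensorVec G.ψ φ)).trace = 1 := by
  rw [ketBra_tensorVec, Matrix.trace_kronecker, trace_ketBra, trace_ketBra, G.norm_ψ, hφ]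
  simp

/-- Boundedness makes the real `sSup` a genuine upper bound; an unbounded set would have the default
supremum `0`. -/
theorem bddAbove_entangledProbs : BddAbove G.entangledProbs := by
  refine ⟨1, ?_⟩
  rintro p ⟨k, l, φ, T, S, hφ, hT, hS, rfl⟩
  refine (G.acceptProb_le_trace (hT.posSemidef_onRegister _
    (hS.posSemidef_onRegister _ (posSemidef_ketBra _)))).trans_eq ?_
  rw [hT.trace_onRegister, hS.trace_onRegister, G.trace_ketBra_tensorVec_ψ hφ, Complex.one_re]

theorem bddAbove_oneWayProbs : BddAbove G.oneWayProbs := by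
  refine ⟨1, ?_⟩
  rintro p ⟨k, T, S, hT, hS, rfl⟩
  refine (G.acceptProb_le_trace (hS.posSemidef_onRegister _
    (hT.posSemidef_onRegister _ (posSemidef_ketBra _)))).trans_eq ?_
  rw [hS.trace_onRegister, hT.trace_onRegister, G.trace_ketBra_tensorVec_ψ (by simp),
    Complex.one_re]

theorem bddAbove_jointProbs : BddAbove G.jointProbs := by
  refine ⟨1, ?_⟩
  rintro p ⟨k, η, T, hη, hT, rfl⟩
  refine (G.acceptProb_le_trace (hT.posSemidef_onRegister _ (posSemidef_ketBra _))).trans_eq ?_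
  rw [hT.trace_onRegister, G.trace_ketBra_tensorVec_ψ hη, Complex.one_re]

theorem entangledValue_nonneg : 0 ≤ G.entangledValue :=
  Real.sSup_nonneg <| by
    rintro p ⟨k, l, φ, T, S, hφ, hT, hS, rfl⟩
    exact G.acceptProb_nonneg (hT.posSemidef_onRegister _
      (hS.posSemidef_onRegister _ (posSemidef_ketBra _)))

theorem oneWayValue_nonneg : 0 ≤ G.oneWayValue :=
  Real.sSup_nonneg <| by
    rintro p ⟨k, T, S, hT, hS, rfl⟩
    exact G.acceptProb_nonneg (hS.posSemidef_onRegister _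
      (hT.posSemidef_onRegister _ (posSemidef_ketBra _)))

/-- Entangled strategies with auxiliary registers of any finite type. -/
theorem acceptProb_le_entangledValue {K L : Type*} [Fintype K] [DecidableEq K] [Fintype L]
    [DecidableEq L] {T : Matrix (A × K) (A × K) ℂ →ₗ[ℂ] Matrix (A × K) (A × K) ℂ}
    {S : Matrix (B × L) (B × L) ℂ →ₗ[ℂ] Matrix (B × L) (B × L) ℂ}
    (hT : IsQuantumOperation T) (hS : IsQuantumOperation S) {φ : EuclideanSpace ℂ (K × L)}
    (hφ : ‖φ‖ = 1) :
    G.acceptProb (onRegister (splitAliceEnt A B C K L) T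
      (onRegister (splitBobEnt A B C K L) S (ketBra (tensorVec G.ψ φ)))) ≤
      G.entangledValue := by
  let f := Fintype.equivFin K
  let g := Fintype.equivFin L
  refine le_csSup G.bddAbove_entangledProbs ⟨Fintype.card K, Fintype.card L,
    WithLp.toLp 2 fun x => φ (f.symm x.1, g.symm x.2),
    transport (Equiv.prodCongr (Equiv.refl A) f) T,
    transport (Equiv.prodCongr (Equiv.refl B) g) S, ?_, hT.transport _, hS.transport _, ?_⟩
  · rw [EuclideanSpace.norm_eq] at hφ ⊢
    rw [← hφ]
    congr 1
    exact (Equiv.prodCongr f g).symm.sum_comp fun x => ‖φ x‖ ^ 2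
  · let h : (A × B × C) × (Fin (Fintype.card K) × Fin (Fintype.card L)) → (A × B × C) × (K × L) :=
      Prod.map id (Equiv.prodCongr f g).symm
    have h1 : ketBra (tensorVec G.ψ (WithLp.toLp 2 fun x => φ (f.symm x.1, g.symm x.2))) =
      (ketBra (tensorVec G.ψ φ)).submatrix h h := rfl
    rw [h1, onRegister_transport (splitBobEnt A B C K L) _ _
        (fun y => (y.1, y.2.1, f.symm y.2.2)) h (fun _ => rfl),
      onRegister_transport (splitAliceEnt A B C K L) _ _
        (fun y => (y.1, y.2.1, g.symm y.2.2)) h (fun _ => rfl), acceptProb_submatrix_equiv]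

/-- Sharing a mixed state does not help in entangled strategies. -/
theorem acceptProb_le_trace_mul_entangledValue {K L : Type*} [Fintype K] [DecidableEq K]
    [Fintype L] [DecidableEq L]
    {T : Matrix (A × K) (A × K) ℂ →ₗ[ℂ] Matrix (A × K) (A × K) ℂ}
    {S : Matrix (B × L) (B × L) ℂ →ₗ[ℂ] Matrix (B × L) (B × L) ℂ}
    (hT : IsQuantumOperation T) (hS : IsQuantumOperation S)
    {ρ : Matrix (K × L) (K × L) ℂ} (hρ : ρ.PosSemidef) :
    G.acceptProb (onRegister (splitAliceEnt A B C K L) T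
      (onRegister (splitBobEnt A B C K L) S (ketBra G.ψ ⊗ₖ ρ))) ≤
      ρ.trace.re * G.entangledValue := by
  have key : ∀ φ : EuclideanSpace ℂ (K × L),
      G.acceptProb (registerMap (splitAliceEnt A B C K L) T
        (registerMap (splitBobEnt A B C K L) S (ketBra G.ψ ⊗ₖ ketBra φ))) ≤
        (ketBra φ).trace.re * G.entangledValue := fun φ => by
    -- A nonzero `φ` is rescaled to a unit vector; the zero vector contributes nothing.
    rcases eq_or_ne φ 0 with rfl | h0
    · have : ketBra (0 : EuclideanSpace ℂ (K × L)) = 0 := by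
        ext x y
        simp [ketBra_apply]
      simp [this, acceptProb]
    · have hn : ‖φ‖ ≠ 0 := norm_ne_zero_iff.mpr h0
      have h1 : ketBra φ = ((‖φ‖ ^ 2 : ℝ) : ℂ) • ketBra (((‖φ‖⁻¹ : ℝ) : ℂ) • φ) := by
        have hc : (‖φ‖ : ℂ) ≠ 0 := by exact_mod_cast hn
        ext x y
        simp only [ketBra_apply, Matrix.smul_apply, PiLp.smul_apply, smul_eq_mul, star_mul',
          Complex.star_def, Complex.conj_ofReal]
        push_cast
        field_simp
      have h2 : ‖((‖φ‖⁻¹ : ℝ) : ℂ) • φ‖ = 1 := by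
        rw [norm_smul, Complex.norm_real, norm_inv, norm_norm, inv_mul_cancel₀ hn]
      rw [trace_ketBra, Complex.ofReal_re]
      conv_lhs => rw [h1]
      rw [Matrix.kronecker_smul, map_smul, map_smul, acceptProb_smul, ← ketBra_tensorVec]
      exact mul_le_mul_of_nonneg_left (G.acceptProb_le_entangledValue hT hS h2) (by positivity)
  -- Decompose `ρ` into rank-one terms; the acceptance probability is linear in the shared state.
  obtain ⟨m, v, hv⟩ := Matrix.posSemidef_iff_eq_sum_vecMulVec.mp hρ
  have hv' : ρ = ∑ i, ketBra (WithLp.toLp 2 (v i)) := hv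
  have hk : ketBra G.ψ ⊗ₖ ρ = ∑ i, ketBra G.ψ ⊗ₖ ketBra (WithLp.toLp 2 (v i)) := by
    ext x y
    simp [hv', Matrix.sum_apply, Finset.mul_sum]
  rw [← registerMap_apply, ← registerMap_apply, hk, map_sum, map_sum, acceptProb_sum, hv',
    Matrix.trace_sum, Complex.re_sum, Finset.sum_mul]
  exact Finset.sum_le_sum fun i _ => key _

/-- One-way strategies with an auxiliary register of any finite type in any state. -/
theorem acceptProb_le_oneWayValue {K : Type*} [Fintype K] [DecidableEq K]
    {T : Matrix (A × K) (A × K) ℂ →ₗ[ℂ] Matrix (A × K) (A × K) ℂ}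
    {S : Matrix (B × K) (B × K) ℂ →ₗ[ℂ] Matrix (B × K) (B × K) ℂ}
    (hT : IsQuantumOperation T) (hS : IsQuantumOperation S) {κ : EuclideanSpace ℂ K}
    (hκ : ‖κ‖ = 1) :
    G.acceptProb (onRegister (splitBobOneWay A B C K) S
      (onRegister (splitAliceOneWay A B C K) T (ketBra (tensorVec G.ψ κ)))) ≤
      G.oneWayValue := by
  obtain ⟨k, hk⟩ : ∃ k, Fintype.card K = k + 1 := by
    refine Nat.exists_eq_succ_of_ne_zero fun h0 => ?_
    have := Fintype.card_eq_zero_iff.mp h0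
    simp [Subsingleton.elim κ 0] at hκ
  let f : K ≃ Fin (k + 1) := Fintype.equivFinOfCardEq hk
  let h : (A × B × C) × Fin (k + 1) → (A × B × C) × K := Prod.map id f.symm
  -- Alice begins by replacing the fixed state of the auxiliary register with `κ`.
  let P := registerMap (Equiv.prodComm A K) (prepareMap κ)
  refine le_csSup G.bddAbove_oneWayProbs ⟨k,
    transport (Equiv.prodCongr (Equiv.refl A) f) (T ∘ₗ P),
    transport (Equiv.prodCongr (Equiv.refl B) f) S,
    (hT.comp ((isQuantumOperation_prepareMap κ hκ).registerMap _)).transport _,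
    hS.transport _, ?_⟩
  have h1 : ketBra (tensorVec G.ψ (EuclideanSpace.single (0 : Fin (k + 1)) (1 : ℂ))) =
      (ketBra (tensorVec G.ψ (EuclideanSpace.single (f.symm 0) (1 : ℂ)))).submatrix h h := by
    ext x y
    simp [ketBra_apply, tensorVec_apply, h]
  have h2 : onRegister (splitAliceOneWay A B C K) P
      (ketBra (tensorVec G.ψ (EuclideanSpace.single (f.symm 0) (1 : ℂ)))) =
        ketBra (tensorVec G.ψ κ) := by
    ext x y
    simp [onRegister_apply, P, registerMap_apply, prepareMap_apply, ketBra_apply, Matrix.trace,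
      tensorVec_apply, splitAliceOneWay]
    ring
  rw [h1, onRegister_transport (splitAliceOneWay A B C K) _ _ id h (fun _ => rfl),
    onRegister_transport (splitBobOneWay A B C K) _ _ id h (fun _ => rfl),
    acceptProb_submatrix_equiv, onRegister_comp, h2]

end Values

end RankOneGame

/-! ### The Bell projection and uncorrected teleportation. -/

section Bell

variable {R E : Type*} [Fintype R] [DecidableEq R] [Fintype E] [DecidableEq E]

/-- The map `⟨Φ| ⊗ 1` on `R × ((R × R) × E)`, where `Φ` is the maximally entangled state of the
first two registers. -/
noncomputable def bellBra (R E : Type*) [Fintype R] [DecidableEq R] [DecidableEq E] :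
    Matrix (R × E) (R × ((R × R) × E)) ℂ :=
  Matrix.of fun y t =>
    ((1 / Real.sqrt (Fintype.card R) : ℝ) : ℂ) * ∑ a, if t = (a, ((a, y.1), y.2)) then 1 else 0

theorem inv_sqrt_mul_self (n : ℕ) :
    ((1 / Real.sqrt n : ℝ) : ℂ) * ((1 / Real.sqrt n : ℝ) : ℂ) = (1 : ℂ) / n := by
  rw [← Complex.ofReal_mul, ← sq, div_pow, Real.sq_sqrt (Nat.cast_nonneg _)]
  push_cast
  ring

theorem bellBra_mul_mul_apply (X : Matrix (R × ((R × R) × E)) (R × ((R × R) × E)) ℂ)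
    (y y' : R × E) :
    (bellBra R E * X * (bellBra R E).conjTranspose) y y' =
      1 / (Fintype.card R : ℂ) *
        ∑ a, ∑ a', X (a, ((a, y.1), y.2)) (a', ((a', y'.1), y'.2)) := by
  rw [← inv_sqrt_mul_self]
  have h (F : R × ((R × R) × E) → ℂ) (y : R × E) : ∑ t, F t * bellBra R E y t =
      ((1 / Real.sqrt (Fintype.card R) : ℝ) : ℂ) * ∑ a, F (a, ((a, y.1), y.2)) := by
    simp only [bellBra, Matrix.of_apply, mul_left_comm (F _), ← Finset.mul_sum]
    simp only [Finset.mul_sum]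
    rw [Finset.sum_comm]
    simp
  have hstar (y : R × E) (t) : star (bellBra R E y t) = bellBra R E y t := by
    simp [bellBra]
  simp only [Matrix.mul_apply, Matrix.conjTranspose_apply, hstar, h, mul_comm (bellBra R E y _)]
  rw [← Finset.mul_sum, mul_assoc, Finset.sum_comm]

/-- The maximally entangled state is a unit vector, so `⟨Φ| ⊗ 1` is a coisometry. -/
theorem bellBra_mul_conjTranspose [Nonempty R] :
    bellBra R E * (bellBra R E).conjTranspose = 1 := by
  have h := bellBra_mul_mul_apply (1 : Matrix (R × ((R × R) × E)) (R × ((R × R) × E)) ℂ)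
  ext y y'
  have hn : (Fintype.card R : ℂ) ≠ 0 := by exact_mod_cast Fintype.card_ne_zero
  have h' := h y y'
  rw [Matrix.mul_one] at h'
  rw [h']
  by_cases hy : y = y'
  · subst hy
    simp [Matrix.one_apply, hn]
  · have : ¬ (y.1 = y'.1 ∧ y.2 = y'.2) := fun h => hy (Prod.ext h.1 h.2)
    rw [Matrix.one_apply_ne hy]
    simp only [Matrix.one_apply, Prod.mk.injEq]
    rw [Finset.sum_eq_zero, mul_zero]
    refine fun a _ => Finset.sum_eq_zero fun a' _ => if_neg ?_
    tauto

/-- A measurement of the first two registers in which the outcome `Φ` leads to moving the third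
register to the place of the first one: a quantum operation one branch of which is teleportation
with the trivial correction. -/
theorem exists_bellOperation (r₀ : R) :
    ∃ P U : Matrix (R × ((R × R) × E)) (R × ((R × R) × E)) ℂ →ₗ[ℂ]
        Matrix (R × ((R × R) × E)) (R × ((R × R) × E)) ℂ,
      IsQuantumOperation (P + U) ∧ IsCompletelyPositive P ∧ IsCompletelyPositive U ∧
      ∀ X x x' e e', P X (x, ((r₀, r₀), e)) (x', ((r₀, r₀), e')) =
        1 / (Fintype.card R : ℂ) * ∑ a, ∑ a', X (a, ((a, x), e)) (a', ((a', x'), e')) := by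
  have : Nonempty R := ⟨r₀⟩
  -- The outcome `Φ` keeps the dimension by resetting the two registers in the pair to `r₀`; this
  -- also lets a later restriction to `(r₀, r₀)` pick out this branch.
  let K : Matrix (R × ((R × R) × E)) (R × ((R × R) × E)) ℂ :=
    Matrix.of fun s t => if s.2.1 = (r₀, r₀) then bellBra R E (s.1, s.2.2) t else 0
  have hK : K.conjTranspose * K = (bellBra R E).conjTranspose * bellBra R E := by
    ext s t
    simp only [K, Matrix.mul_apply, Matrix.conjTranspose_apply, Matrix.of_apply,
      Fintype.sum_prod_type]
    refine Finset.sum_congr rfl fun x _ => ?_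
    rw [Finset.sum_eq_single r₀ (by intro b _ hb; simp [hb]) (by simp),
      Finset.sum_eq_single r₀ (by intro b _ hb; simp [hb]) (by simp)]
    simp
  obtain ⟨U, hU, hQ⟩ := exists_isQuantumOperation_conjMap_add K
    (hK ▸ posSemidef_one_sub_conjTranspose_mul bellBra_mul_conjTranspose)
  refine ⟨conjMap K, U, hQ, isCompletelyPositive_conjMap K, hU, fun X x x' e e' => ?_⟩
  rw [← bellBra_mul_mul_apply X (x, e) (x', e'), conjMap_apply]
  simp [K, Matrix.mul_apply]

end Bell

/-! ### The optimality bounds by teleportation. -/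

namespace RankOneGame

variable {A B C : Type*} [Fintype A] [Fintype B] [Fintype C]

/-- Postselection only discards nonnegative contributions: those of the branch `U`, and those of
auxiliary outcomes outside the range of `f`. -/
theorem acceptProb_branch_le (G : RankOneGame A B C) {R F E E' : Type*} [Finite F]
    [Fintype R] [Fintype E] [DecidableEq E] [Fintype E'] [DecidableEq E']
    (e : (A × B × C) × E ≃ R × F) {P U : Matrix R R ℂ →ₗ[ℂ] Matrix R R ℂ}
    (hP : IsCompletelyPositive P) (hU : IsCompletelyPositive U)
    {ρ : Matrix ((A × B × C) × E) ((A × B × C) × E) ℂ} (hρ : ρ.PosSemidef)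
    {f : E' → E} (hf : Function.Injective f) :
    G.acceptProb ((onRegister e P ρ).submatrix (Prod.map id f) (Prod.map id f)) ≤
      G.acceptProb (onRegister e (P + U) ρ) := by
  rw [onRegister_add, acceptProb_add]
  exact (G.acceptProb_submatrix_le (hP.posSemidef_onRegister e hρ) hf).trans
    (le_add_of_nonneg_right (G.acceptProb_nonneg (hU.posSemidef_onRegister e hρ)))

/-- Instead of sending a register to Bob, the players share the Choi state of Alice's operation,
and Alice teleports her input into it, succeeding with probability `|A|⁻²`. -/
theorem oneWayValue_le [DecidableEq A] [Nonempty A] (G : RankOneGame A B C) :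
    G.oneWayValue ≤ (Fintype.card A : ℝ) ^ 2 * G.entangledValue := by
  refine Real.sSup_le ?_ (mul_nonneg (sq_nonneg _) G.entangledValue_nonneg)
  rintro p ⟨k, T, S, hT, hS, rfl⟩
  obtain ⟨r₀⟩ := ‹Nonempty A›
  have hn : (0 : ℝ) < Fintype.card A := by
    exact_mod_cast Fintype.card_pos_iff.mpr ⟨r₀⟩
  obtain ⟨P, U, hQ, hP, hU, hPX⟩ := exists_bellOperation (E := Unit) r₀
  -- Unnormalized `∑ₐ |a⟩|0⟩|a⟩`: the Choi state `ρ` has trace `|A|`, so one factor `|A|` comes from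
  -- `hρt` and the other from the Bell projection.
  let v : EuclideanSpace ℂ ((A × Fin (k + 1)) × A) :=
    WithLp.toLp 2 fun x => if x.1.1 = x.2 ∧ x.1.2 = 0 then 1 else 0
  -- Alice holds the reference half and the `A`-output of `T`; Bob holds the message.
  let g : ((A × A) × Unit) × Fin (k + 1) ≃ (A × Fin (k + 1)) × A :=
    { toFun := fun x => ((x.1.1.2, x.2), x.1.1.1)
      invFun := fun y => (((y.2, y.1.1), ()), y.1.2)
      left_inv := fun _ => rfl
      right_inv := fun _ => rfl }
  let ρ := (onRegister (Equiv.refl _) T (ketBra v)).submatrix g g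
  have hρ : ρ.PosSemidef := (hT.posSemidef_onRegister _ (posSemidef_ketBra v)).submatrix _
  have hρt : ρ.trace.re = Fintype.card A := by
    have h1 : ρ.trace = (onRegister (Equiv.refl _) T (ketBra v)).trace :=
      g.sum_comp fun x => onRegister (Equiv.refl _) T (ketBra v) x x
    rw [h1, hT.trace_onRegister]
    simp [Matrix.trace, ketBra_apply, v, Fintype.sum_prod_type, ite_and]
  have key : (onRegister (splitAliceEnt A B C ((A × A) × Unit) (Fin (k + 1))) P
      (onRegister (splitBobEnt A B C ((A × A) × Unit) (Fin (k + 1))) S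
        (ketBra G.ψ ⊗ₖ ρ))).submatrix
          (Prod.map id fun j => (((r₀, r₀), ()), j)) (Prod.map id fun j => (((r₀, r₀), ()), j)) =
      ((1 / (Fintype.card A : ℝ) : ℝ) : ℂ) • onRegister (splitBobOneWay A B C (Fin (k + 1))) S
          (onRegister (splitAliceOneWay A B C (Fin (k + 1))) T
            (ketBra (tensorVec G.ψ (EuclideanSpace.single 0 1)))) := by
    ext s t
    obtain ⟨⟨a, b, c⟩, j⟩ := s
    obtain ⟨⟨a', b', c'⟩, j'⟩ := t
    have h := hPX (Matrix.of fun i i' => onRegister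
      (splitBobEnt A B C ((A × A) × Unit) (Fin (k + 1))) S (ketBra G.ψ ⊗ₖ ρ)
        ((splitAliceEnt A B C ((A × A) × Unit) (Fin (k + 1))).symm (i, (b, c, j)))
        ((splitAliceEnt A B C ((A × A) × Unit) (Fin (k + 1))).symm (i', (b', c', j'))))
      a a' () ()
    refine h.trans ?_
    rw [Matrix.smul_apply, smul_eq_mul]
    push_cast
    congr 1
    -- By linearity the Bell sum over `a₁, a₁'` moves inside `S` and then `T`, where contraction
    -- with `v` puts the input `ψ` in place of the reference.
    let M (a₁ a₁' : A) : Matrix (B × Fin (k + 1)) (B × Fin (k + 1)) ℂ :=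
      Matrix.of fun i i' => G.ψ (a₁, i.1, c) * star (G.ψ (a₁', i'.1, c')) *
        T (Matrix.of fun x x' => ketBra v (x, a₁) (x', a₁')) (a, i.2) (a', i'.2)
    have hl : ∑ a₁, ∑ a₁', S (M a₁ a₁') (b, j) (b', j') =
        S (∑ a₁, ∑ a₁', M a₁ a₁') (b, j) (b', j') := by
      simp only [map_sum, Matrix.sum_apply]
    refine hl.trans (congrFun₂ (congrArg S ?_) _ _)
    ext i i'
    have hr : ∑ a₁, ∑ a₁', M a₁ a₁' i i' =
        T (∑ a₁, ∑ a₁', (G.ψ (a₁, i.1, c) * star (G.ψ (a₁', i'.1, c'))) •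
          Matrix.of fun x x' => ketBra v (x, a₁) (x', a₁')) (a, i.2) (a', i'.2) := by
      simp only [map_sum, map_smul, Matrix.sum_apply, Matrix.smul_apply, smul_eq_mul]
      rfl
    simp only [Matrix.sum_apply]
    refine hr.trans (congrFun₂ (congrArg T ?_) _ _)
    ext x x'
    simp [Matrix.sum_apply, ketBra_apply, tensorVec_apply, v, splitAliceOneWay, splitBobOneWay,
      ite_and, apply_ite (starRingEnd ℂ)]
  have h1 := G.acceptProb_branch_le (splitAliceEnt A B C ((A × A) × Unit) (Fin (k + 1))) hP hU
    (hS.posSemidef_onRegister (splitBobEnt A B C ((A × A) × Unit) (Fin (k + 1)))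
      ((posSemidef_ketBra G.ψ).kronecker hρ))
    (f := fun j => (((r₀, r₀), ()), j)) (fun _ _ h => congrArg Prod.snd h)
  have h2 := G.acceptProb_le_trace_mul_entangledValue hQ hS hρ
  rw [key, acceptProb_smul] at h1
  rw [hρt] at h2
  have h3 := h1.trans h2
  rw [one_div, inv_mul_le_iff₀ hn] at h3
  rw [sq, mul_assoc]
  exact h3

/-- Alice applies the joint operation to her register and to one half of a maximally entangled
state, and sends the result to Bob, who teleports his input into it, succeeding with probability
`|B|⁻²`. -/
theorem maximalValue_le [DecidableEq B] [Nonempty B] (G : RankOneGame A B C) :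
    G.maximalValue ≤ (Fintype.card B : ℝ) ^ 2 * G.oneWayValue := by
  refine Real.sSup_le ?_ (mul_nonneg (sq_nonneg _) G.oneWayValue_nonneg)
  rintro p ⟨k, η, T, hη, hT, rfl⟩
  obtain ⟨r₀⟩ := ‹Nonempty B›
  have hn : (0 : ℝ) < Fintype.card B := by
    exact_mod_cast Fintype.card_pos_iff.mpr ⟨r₀⟩
  obtain ⟨P, U, hQ, hP, hU, hPX⟩ := exists_bellOperation (E := Fin k) r₀
  -- This pair is normalized, so both factors `1 / |B|` appear in `key`: one from `κ`, one from the
  -- Bell projection.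
  let κ : EuclideanSpace ℂ ((B × B) × Fin k) :=
    WithLp.toLp 2 fun x => ((1 / Real.sqrt (Fintype.card B) : ℝ) : ℂ) *
      if x.1.1 = x.1.2 then η x.2 else 0
  have hκ : ‖κ‖ = 1 := by
    have h1 : ‖κ‖ ^ 2 = 1 := by
      have h2 : ∑ i, ‖η i‖ ^ 2 = 1 := by rw [← EuclideanSpace.norm_sq_eq, hη, one_pow]
      rw [EuclideanSpace.norm_sq_eq]
      simp only [κ, norm_mul, mul_pow, ← Finset.mul_sum, Fintype.sum_prod_type,
        apply_ite (fun z : ℂ => ‖z‖ ^ 2)]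
      simp [h2, hn.ne']
    nlinarith [norm_nonneg κ]
  -- `T` acts on `A`, the second half of the pair and the ancilla; the first half is left for Bob's
  -- Bell projection.
  let g : A × ((B × B) × Fin k) ≃ (A × B × Fin k) × B :=
    { toFun := fun x => ((x.1, x.2.1.2, x.2.2), x.2.1.1)
      invFun := fun y => (y.1.1, ((y.2, y.1.2.1), y.1.2.2))
      left_inv := fun _ => rfl
      right_inv := fun _ => rfl }
  have key : (onRegister (splitBobOneWay A B C ((B × B) × Fin k)) P
      (onRegister (splitAliceOneWay A B C ((B × B) × Fin k)) (registerMap g T)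
        (ketBra (tensorVec G.ψ κ)))).submatrix
          (Prod.map id fun j => ((r₀, r₀), j)) (Prod.map id fun j => ((r₀, r₀), j)) =
      (((1 / (Fintype.card B : ℝ)) ^ 2 : ℝ) : ℂ) • onRegister (splitJoint A B C (Fin k)) T
          (ketBra (tensorVec G.ψ η)) := by
    ext s t
    obtain ⟨⟨a, b, c⟩, j⟩ := s
    obtain ⟨⟨a', b', c'⟩, j'⟩ := t
    have h := hPX (Matrix.of fun i i' => onRegister
      (splitAliceOneWay A B C ((B × B) × Fin k)) (registerMap g T) (ketBra (tensorVec G.ψ κ))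
        ((splitBobOneWay A B C ((B × B) × Fin k)).symm (i, (a, c)))
        ((splitBobOneWay A B C ((B × B) × Fin k)).symm (i', (a', c'))))
      b b' j j'
    refine h.trans ?_
    rw [Matrix.smul_apply, smul_eq_mul, sq, Complex.ofReal_mul, mul_assoc]
    congr 1
    · push_cast
      rfl
    let M (b₁ b₁' : B) : Matrix (A × B × Fin k) (A × B × Fin k) ℂ :=
      Matrix.of fun i i' => G.ψ (i.1, b₁, c) * star (G.ψ (i'.1, b₁', c')) *
        ketBra κ ((b₁, i.2.1), i.2.2) ((b₁', i'.2.1), i'.2.2)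
    have hl : ∑ b₁, ∑ b₁', T (M b₁ b₁') (a, b, j) (a', b', j') =
        T (∑ b₁, ∑ b₁', M b₁ b₁') (a, b, j) (a', b', j') := by
      simp only [map_sum, Matrix.sum_apply]
    have hm : ∀ b₁ b₁', T (M b₁ b₁') (a, b, j) (a', b', j') = onRegister
      (splitAliceOneWay A B C ((B × B) × Fin k)) (registerMap g T) (ketBra (tensorVec G.ψ κ))
        ((a, b₁, c), ((b₁, b), j)) ((a', b₁', c'), ((b₁', b'), j')) := fun b₁ b₁' => by
      refine congrFun₂ (congrArg T ?_) _ _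
      ext i i'
      simp [M, ketBra_apply, tensorVec_apply, g, splitAliceOneWay]
      ring
    simp only [hm] at hl
    refine hl.trans ?_
    have hr : ∑ b₁, ∑ b₁', M b₁ b₁' = ((1 / (Fintype.card B : ℝ) : ℝ) : ℂ) • Matrix.of
        fun i i' => ketBra (tensorVec G.ψ η) ((splitJoint A B C (Fin k)).symm (i, c))
          ((splitJoint A B C (Fin k)).symm (i', c')) := by
      ext i i'
      have hc : ((1 / (Fintype.card B : ℝ) : ℝ) : ℂ) = (1 : ℂ) / Fintype.card B := by
        push_cast
        rfl
      rw [hc, ← inv_sqrt_mul_self]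
      simp [Matrix.sum_apply, M, ketBra_apply, tensorVec_apply, κ, splitJoint,
        apply_ite (starRingEnd ℂ)]
      ring
    rw [hr, map_smul]
    rfl
  have h1 := G.acceptProb_branch_le (splitBobOneWay A B C ((B × B) × Fin k)) hP hU
    ((hT.registerMap g).posSemidef_onRegister (splitAliceOneWay A B C ((B × B) × Fin k))
      (posSemidef_ketBra (tensorVec G.ψ κ)))
    (f := fun j => ((r₀, r₀), j)) (fun _ _ h => congrArg Prod.snd h)
  have h2 := G.acceptProb_le_oneWayValue (hT.registerMap g) hQ hκ
  rw [key, acceptProb_smul] at h1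
  have h3 := h1.trans h2
  rw [one_div, inv_pow, inv_mul_le_iff₀ (by positivity)] at h3
  exact h3

end RankOneGame

/-! ### Overlaps with maximally entangled states. -/

theorem uniformState_apply {ι : Type*} [DecidableEq ι] (n : ℕ) (f : Fin n → ι) (x : ι) :
    uniformState n f x = ((1 / Real.sqrt n : ℝ) : ℂ) * ∑ i, if x = f i then 1 else 0 := by
  simp [uniformState, Pi.single_apply]

theorem trace_ketBra_uniformState_mul {ι : Type*} [Fintype ι] [DecidableEq ι] (n : ℕ) (f : Fin n → ι) (M : Matrix ι ι ℂ) :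
    (ketBra (uniformState n f) * M).trace = 1 / (n : ℂ) * ∑ i, ∑ j, M (f j) (f i) := by
  rw [← inv_sqrt_mul_self]
  have h (F : ι → ℂ) : ∑ t, uniformState n f t * F t =
      ((1 / Real.sqrt n : ℝ) : ℂ) * ∑ i, F (f i) := by
    simp only [uniformState_apply, mul_assoc, ← Finset.mul_sum]
    simp only [Finset.sum_mul]
    rw [Finset.sum_comm]
    simp
  have hstar (t : ι) : star (uniformState n f t) = uniformState n f t := by
    simp [uniformState_apply]
  simp only [Matrix.trace, Matrix.diag, Matrix.mul_apply, ketBra_apply, hstar, mul_assoc,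
    ← Finset.mul_sum, h]

/-- A register which is maximally mixed and uncorrelated with the input of `T` overlaps with the
(unnormalized) maximally entangled state as if the latter were a multiple of the identity. -/
theorem sum_diagonal_blocks (n : ℕ) {K : Type*} [Fintype K]
    {T : Matrix (Fin n × K) (Fin n × K) ℂ →ₗ[ℂ] Matrix (Fin n × K) (Fin n × K) ℂ}
    (hT : IsQuantumOperation T) (N : Matrix (Fin n × K) (Fin n × K) ℂ)
    (M : Fin n → Fin n → Matrix (Fin n × K) (Fin n × K) ℂ)
    (hM : ∀ i j, M i j = if i = j then N else 0) :
    ∑ k, ∑ i, ∑ j, T (M i j) (j, k) (i, k) = N.trace := by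
  rw [← hT.tracePreserving, Matrix.trace, Fintype.sum_prod_type_right]
  refine Finset.sum_congr rfl fun k _ => Finset.sum_congr rfl fun i _ => ?_
  rw [Finset.sum_eq_single i (fun j _ hj => by simp [hM, Ne.symm hj]) (by simp)]
  simp [hM]

/-- If the referee's measurement projects onto `n^{-1/2} ∑ᵢ |f a₀ i⟩`, then the acceptance
probability is at most the sum of the probabilities for the vectors `n^{-1/2} ∑ᵢ |f a i⟩`. -/
theorem RankOneGame.acceptProb_le_of_γ_eq {A B C E ι : Type*} [Fintype A] [Fintype B] [Fintype C]
    [DecidableEq A] [DecidableEq B] [DecidableEq C] [Fintype E] [DecidableEq E] [Fintype ι]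
    (G : RankOneGame A B C) (n : ℕ) (f : ι → Fin n → A × B × C) (a₀ : ι)
    (hγ : G.γ = uniformState n (f a₀))
    {ρ : Matrix ((A × B × C) × E) ((A × B × C) × E) ℂ} (hρ : ρ.PosSemidef) {z : ℂ}
    (hz : ∑ e, ∑ i, ∑ j, ∑ a, ρ (f a j, e) (f a i, e) = z) :
    G.acceptProb ρ ≤ (1 / (n : ℂ) * z).re := by
  rw [acceptProb_eq_sum, ← hz, Finset.mul_sum, Complex.re_sum]
  refine Finset.sum_le_sum fun e _ => ?_
  have h := Finset.single_le_sum (f := fun a =>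
    (ketBra (uniformState n (f a)) * ρ.submatrix (fun x => (x, e)) fun x => (x, e)).trace.re)
    (fun a _ => re_trace_mul_nonneg (posSemidef_ketBra _) (hρ.submatrix _))
    (Finset.mem_univ a₀)
  rw [hγ]
  refine h.trans_eq ?_
  simp only [trace_ketBra_uniformState_mul, ← Complex.re_sum, ← Finset.mul_sum,
    Matrix.submatrix_apply]
  rw [Finset.sum_comm]
  simp only [Finset.sum_comm (s := (Finset.univ : Finset ι))]

theorem RankOneGame.acceptProb_ketBra_γ {A B C E : Type*} [Fintype A] [Fintype B] [Fintype C]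
    [Fintype E] [DecidableEq E] (G : RankOneGame A B C) {η : EuclideanSpace ℂ E}
    (hη : ‖η‖ = 1) : G.acceptProb (ketBra (tensorVec G.γ η)) = 1 := by
  have h1 : ketBra G.γ * ketBra G.γ = ketBra G.γ := by
    have h := trace_ketBra G.γ
    simp only [G.norm_γ, Matrix.trace, Matrix.diag, ketBra_apply] at h
    ext x y
    simp only [Matrix.mul_apply, ketBra_apply]
    calc ∑ z, G.γ x * star (G.γ z) * (G.γ z * star (G.γ y))
        = (∑ z, G.γ z * star (G.γ z)) * (G.γ x * star (G.γ y)) := by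
          rw [Finset.sum_mul]
          exact Finset.sum_congr rfl fun z _ => by ring
      _ = _ := by rw [h]; simp
  rw [acceptProb, ketBra_tensorVec, ← Matrix.mul_kronecker_mul, h1, Matrix.one_mul,
    Matrix.trace_kronecker, trace_ketBra, trace_ketBra, G.norm_γ, hη]
  simp

/-! ### The values of the games `gameC` and `gameR`. -/

section Games

variable (n : ℕ) [NeZero n]

theorem gameC_ψ_apply (a b c : Fin n) :
    (gameC n).ψ (a, b, c) = if b = 0 ∧ a = c then ((1 / Real.sqrt n : ℝ) : ℂ) else 0 := by
  have h : ∀ i, (a, b, c) = (i, (0 : Fin n), i) ↔ a = i ∧ b = 0 ∧ c = i := by simp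
  change uniformState n (fun i => (i, 0, i)) (a, b, c) = _
  simp only [uniformState_apply, h, ite_and, Finset.sum_ite_eq, Finset.mem_univ, if_true]
  by_cases hb : b = 0 <;> simp [hb, eq_comm]

theorem gameR_ψ_apply (a b c : Fin n) :
    (gameR n).ψ (a, b, c) = if a = 0 ∧ b = c then ((1 / Real.sqrt n : ℝ) : ℂ) else 0 := by
  have h : ∀ i, (a, b, c) = ((0 : Fin n), i, i) ↔ b = i ∧ a = 0 ∧ c = i := by simp; tauto
  change uniformState n (fun i => (0, i, i)) (a, b, c) = _
  simp only [uniformState_apply, h, ite_and, Finset.sum_ite_eq, Finset.mem_univ, if_true]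
  by_cases ha : a = 0 <;> simp [ha, eq_comm]

theorem gameC_γ_apply (a b c : Fin n) :
    (gameC n).γ (a, b, c) = if a = 0 ∧ b = c then ((1 / Real.sqrt n : ℝ) : ℂ) else 0 :=
  gameR_ψ_apply n a b c

theorem gameR_γ_apply (a b c : Fin n) :
    (gameR n).γ (a, b, c) = if b = 0 ∧ a = c then ((1 / Real.sqrt n : ℝ) : ℂ) else 0 :=
  gameC_ψ_apply n a b c

/-- Alice swaps `A` into the message and Bob swaps the message into `B`, which turns `ψ ⊗ |0⟩` into
`γ ⊗ |0⟩`. -/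
theorem one_le_oneWayValue_gameC : 1 ≤ (gameC n).oneWayValue := by
  have h := (gameC n).acceptProb_le_oneWayValue
    (isQuantumOperation_permMap (Equiv.prodComm (Fin n) (Fin n)))
    (isQuantumOperation_permMap (Equiv.prodComm (Fin n) (Fin n)))
    (κ := EuclideanSpace.single 0 1) (by simp)
  refine le_of_eq_of_le ?_ h
  rw [← (gameC n).acceptProb_ketBra_γ (η := EuclideanSpace.single (0 : Fin n) 1) (by simp)]
  congr 1
  have hv : ∀ a b c k : Fin n,
      tensorVec (gameC n).γ (EuclideanSpace.single (0 : Fin n) 1) ((a, b, c), k) =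
        tensorVec (gameC n).ψ (EuclideanSpace.single (0 : Fin n) 1) ((b, k, c), a) := by
    intro a b c k
    simp only [tensorVec_apply, gameC_ψ_apply, gameC_γ_apply, PiLp.single_apply]
    split_ifs <;> simp_all
  ext ⟨⟨a, b, c⟩, k⟩ ⟨⟨a', b', c'⟩, k'⟩
  rw [ketBra_apply, hv, hv]
  rfl

theorem one_le_maximalValue_gameR : 1 ≤ (gameR n).maximalValue := by
  let σ : Fin n × Fin n × Fin 1 ≃ Fin n × Fin n × Fin 1 :=
    { toFun := fun x => (x.2.1, x.1, x.2.2)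
      invFun := fun x => (x.2.1, x.1, x.2.2)
      left_inv := fun _ => rfl
      right_inv := fun _ => rfl }
  refine le_csSup (gameR n).bddAbove_jointProbs ⟨1, EuclideanSpace.single 0 1, permMap σ,
    by simp, isQuantumOperation_permMap σ, ?_⟩
  rw [← (gameR n).acceptProb_ketBra_γ (η := EuclideanSpace.single (0 : Fin 1) 1) (by simp)]
  congr 1
  have hv : ∀ (a b c : Fin n) (k : Fin 1),
      tensorVec (gameR n).γ (EuclideanSpace.single (0 : Fin 1) 1) ((a, b, c), k) =
        tensorVec (gameR n).ψ (EuclideanSpace.single (0 : Fin 1) 1) ((b, a, c), k) := by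
    intro a b c k
    simp only [tensorVec_apply, gameR_ψ_apply, gameR_γ_apply]
  ext ⟨⟨a, b, c⟩, k⟩ ⟨⟨a', b', c'⟩, k'⟩
  rw [ketBra_apply, hv, hv]
  rfl

theorem entangledValue_gameC_le : (gameC n).entangledValue ≤ 1 / (n : ℝ) ^ 2 := by
  refine Real.sSup_le ?_ (by positivity)
  rintro p ⟨k, l, φ, T, S, hφ, hT, hS, rfl⟩
  set X := ketBra (tensorVec (gameC n).ψ φ) with hX
  let Y := onRegister (splitBobEnt (Fin n) (Fin n) (Fin n) (Fin k) (Fin l)) S X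
  -- Tracing out `A A'` leaves `N ⊗ 1_C`, where `N` is `1/n` times Bob's state `|0⟩⟨0| ⊗ tr_{A'}
  -- |φ⟩⟨φ|`; `M i j` are its blocks over `C`.
  let N : Matrix (Fin n × Fin l) (Fin n × Fin l) ℂ := Matrix.of fun x x' =>
    1 / (n : ℂ) * if x.1 = 0 ∧ x'.1 = 0 then ∑ d, φ (d, x.2) * star (φ (d, x'.2)) else 0
  have hN : N.trace = 1 / n := by
    have h := trace_ketBra φ
    rw [hφ, Matrix.trace, Fintype.sum_prod_type_right] at h
    simp only [Matrix.diag, ketBra_apply] at h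
    simp only [Matrix.trace, Matrix.diag, N, Matrix.of_apply, Fintype.sum_prod_type, and_self]
    rw [Finset.sum_eq_single 0 (by intro b _ hb; simp [hb]) (by simp)]
    simp only [if_true, ← Finset.mul_sum, h]
    simp
  let M (i j : Fin n) : Matrix (Fin n × Fin l) (Fin n × Fin l) ℂ :=
    ∑ r : Fin n × Fin k,
      Matrix.of fun x x' => X ((r.1, x.1, j), (r.2, x.2)) ((r.1, x'.1, i), (r.2, x'.2))
  have hY : ∀ (i j : Fin n) (e : Fin l),
      ∑ r : Fin n × Fin k, Y ((r.1, j, j), (r.2, e)) ((r.1, i, i), (r.2, e)) =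
        S (M i j) (j, e) (i, e) := fun i j e => by
    simp only [M, map_sum, Matrix.sum_apply]
    rfl
  have hc : ((Real.sqrt n : ℂ))⁻¹ * (Real.sqrt n : ℂ)⁻¹ = (n : ℂ)⁻¹ := by
    simpa using inv_sqrt_mul_self n
  have hM : ∀ i j, M i j = if i = j then N else 0 := fun i j => by
    ext x x'
    simp only [M, Matrix.sum_apply, Matrix.of_apply, hX, ketBra_apply, tensorVec_apply,
      gameC_ψ_apply, Fintype.sum_prod_type, star_mul', apply_ite star, Complex.star_def,
      Complex.conj_ofReal]
    by_cases hx : x.1 = 0 <;> by_cases hx' : x'.1 = 0 <;> by_cases hij : i = j <;>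
      simp [N, hx, hx', hij, Finset.mul_sum]
    refine Finset.sum_congr rfl fun d _ => ?_
    rw [mul_mul_mul_comm, hc]
  -- Summing over `a` makes the test ignore `A`, so trace preservation removes Alice's operation.
  have key := (gameC n).acceptProb_le_of_γ_eq n (fun a i => (a, i, i)) 0 rfl
    (hT.posSemidef_onRegister (splitAliceEnt (Fin n) (Fin n) (Fin n) (Fin k) (Fin l))
      (hS.posSemidef_onRegister _ (posSemidef_ketBra _))) (z := 1 / (n : ℂ)) (by
    rw [← hN, ← sum_diagonal_blocks n hS N M hM, Fintype.sum_prod_type_right]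
    refine Finset.sum_congr rfl fun e _ => ?_
    rw [Finset.sum_comm]
    refine Finset.sum_congr rfl fun i _ => ?_
    rw [Finset.sum_comm]
    refine Finset.sum_congr rfl fun j _ => ?_
    rw [← hY, Finset.sum_comm, ← Fintype.sum_prod_type']
    exact hT.sum_onRegister (splitAliceEnt (Fin n) (Fin n) (Fin n) (Fin k) (Fin l)) Y
      (j, j, e) (i, i, e))
  refine key.trans_eq ?_
  rw [← Complex.ofReal_natCast, ← Complex.ofReal_one, ← Complex.ofReal_div, ← Complex.ofReal_mul,
    Complex.ofReal_re]
  ring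

theorem oneWayValue_gameR_le : (gameR n).oneWayValue ≤ 1 / (n : ℝ) ^ 2 := by
  refine Real.sSup_le ?_ (by positivity)
  rintro p ⟨k, T, S, hT, hS, rfl⟩
  set X := ketBra (tensorVec (gameR n).ψ (EuclideanSpace.single (0 : Fin (k + 1)) 1)) with hX
  let Y := onRegister (splitAliceOneWay (Fin n) (Fin n) (Fin n) (Fin (k + 1))) T X
  -- Here `B`, which purifies `C`, is traced out; Alice's registers are in the state `|0⟩|0⟩`,
  -- independent of `C`.
  let N : Matrix (Fin n × Fin (k + 1)) (Fin n × Fin (k + 1)) ℂ := Matrix.of fun x x' =>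
    1 / (n : ℂ) * if x = 0 ∧ x' = 0 then 1 else 0
  have hN : N.trace = 1 / n := by
    simp only [Matrix.trace, Matrix.diag, N, Matrix.of_apply, and_self]
    rw [← Finset.mul_sum]
    simp
  let M (i j : Fin n) : Matrix (Fin n × Fin (k + 1)) (Fin n × Fin (k + 1)) ℂ :=
    ∑ b, Matrix.of fun x x' => X ((x.1, b, j), x.2) ((x'.1, b, i), x'.2)
  have hY : ∀ (i j : Fin n) (d : Fin (k + 1)),
      ∑ b, Y ((j, b, j), d) ((i, b, i), d) = T (M i j) (j, d) (i, d) := fun i j d => by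
    simp only [M, map_sum, Matrix.sum_apply]
    rfl
  have hc : ((Real.sqrt n : ℂ))⁻¹ * (Real.sqrt n : ℂ)⁻¹ = (n : ℂ)⁻¹ := by
    simpa using inv_sqrt_mul_self n
  have hM : ∀ i j, M i j = if i = j then N else 0 := fun i j => by
    ext ⟨x, d⟩ ⟨x', d'⟩
    simp only [M, Matrix.sum_apply, Matrix.of_apply, hX, ketBra_apply, tensorVec_apply,
      gameR_ψ_apply, star_mul', apply_ite star, Complex.star_def, Complex.conj_ofReal,
      PiLp.single_apply]
    by_cases hx : x = 0 <;> by_cases hx' : x' = 0 <;> by_cases hij : i = j <;>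
      by_cases hd : d = 0 <;> by_cases hd' : d' = 0 <;>
      simp [N, hx, hx', hij, hd, hd', hc]
  -- Now the test ignores `B`, and it is Bob's operation that drops out, even though it acts on the
  -- message.
  have key := (gameR n).acceptProb_le_of_γ_eq n (fun b i => (i, b, i)) 0 rfl
    (hS.posSemidef_onRegister (splitBobOneWay (Fin n) (Fin n) (Fin n) (Fin (k + 1)))
      (hT.posSemidef_onRegister _ (posSemidef_ketBra _))) (z := 1 / (n : ℂ)) (by
    rw [← hN, ← sum_diagonal_blocks n hT N M hM]
    simp only [← hY]
    simp only [Finset.sum_comm (s := (Finset.univ : Finset (Fin (k + 1))))]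
    refine Finset.sum_congr rfl fun i _ => Finset.sum_congr rfl fun j _ => ?_
    have h := hS.sum_onRegister (splitBobOneWay (Fin n) (Fin n) (Fin n) (Fin (k + 1))) Y
      (j, j) (i, i)
    rw [Fintype.sum_prod_type, Fintype.sum_prod_type] at h
    exact h)
  refine key.trans_eq ?_
  rw [← Complex.ofReal_natCast, ← Complex.ofReal_one, ← Complex.ofReal_div, ← Complex.ofReal_mul,
    Complex.ofReal_re]
  ring

end Games
end QuantumGame

theorem mainTheorem5 (n : ℕ) [NeZero n] :
    (QuantumGame.gameC n).oneWayValue / (QuantumGame.gameC n).entangledValue = (n : ℝ) ^ 2 ∧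
    (QuantumGame.gameR n).maximalValue / (QuantumGame.gameR n).oneWayValue = (n : ℝ) ^ 2 ∧
    ∀ (c : ℕ) (G : QuantumGame.RankOneGame (Fin n) (Fin n) (Fin c)),
      G.oneWayValue ≤ (n : ℝ) ^ 2 * G.entangledValue ∧
      G.maximalValue ≤ (n : ℝ) ^ 2 * G.oneWayValue := by
  have hn : (0 : ℝ) < (n : ℝ) ^ 2 := by
    have : (0 : ℝ) < n := by exact_mod_cast Nat.pos_of_ne_zero (NeZero.ne n)
    positivity
  -- The general inequality supplies the missing lower bound on `v`, forcing equality throughout and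
  -- `v ≠ 0`.
  have hratio : ∀ u v : ℝ, 1 ≤ u → u ≤ (n : ℝ) ^ 2 * v → v ≤ 1 / (n : ℝ) ^ 2 →
      u / v = (n : ℝ) ^ 2 := fun u v h1 h2 h3 => by
    have h4 : (n : ℝ) ^ 2 * v ≤ 1 := by rwa [le_div_iff₀' hn] at h3
    have h5 : u = (n : ℝ) ^ 2 * v := by linarith
    have h6 : v ≠ 0 := by
      rintro rfl
      linarith [mul_zero ((n : ℝ) ^ 2)]
    rw [h5, mul_div_cancel_right₀ _ h6]
  have hopt : ∀ (c : ℕ) (G : QuantumGame.RankOneGame (Fin n) (Fin n) (Fin c)),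
      G.oneWayValue ≤ (n : ℝ) ^ 2 * G.entangledValue ∧
      G.maximalValue ≤ (n : ℝ) ^ 2 * G.oneWayValue := fun c G => by
    simpa using And.intro G.oneWayValue_le G.maximalValue_le
  exact ⟨hratio _ _ (QuantumGame.one_le_oneWayValue_gameC n) (hopt n _).1
      (QuantumGame.entangledValue_gameC_le n),
    hratio _ _ (QuantumGame.one_le_maximalValue_gameR n) (hopt n _).2
      (QuantumGame.oneWayValue_gameR_le n), hopt⟩
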